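/- An affine algebraic Riemann surface is a connected smooth closed algebraic curve $R\subset\mathbb C^N$. A compact set $K\subset R$ is Runge if $R\setminus K$ has no relatively compact connected components. A complex algebraic manifold $X$ is called aOka-1 if for every affine algebraic Riemann surface $R$, every Runge compact set $K\subset R$, every finite set $A\subset K$, every continuous map $f:R\to X$ that is holomorphic on a neighbourhood of $K$, every $\epsilon>0$ and every integer $k\ge 1$, there is a morphism of algebraic varieties $F:R\to X$ that is homotopic to $f$ and satisfies (1) $\mathrm{dist}_X(F(p),f(p))<\epsilon$ for all $p\in K$, and (2) $F$ agrees with $f$ to order $k$ at every point of $A$. Here $\mathrm{dist}_X$ is a distance function inducing the manifold topology of $X$ (the notion does not depend on its choice). A connected projective manifold $X$ is called rationally connected if for any two points $p,q\in X$ there is a morphism $\mathbb P^1\to X$ whose image contains $p$ and $q$. **Proposition.** Every connected projective aOka-1 manifold is rationally connected. More generally, if $X\subset\mathbb P^n$ is a projective aOka-1 manifold, not necessarily connected, then every connected component of $X$ is rationally connected. -/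

import Mathlib

open Topology Asymptotics
open scoped LinearAlgebra.Projectivization

noncomputable section

/-- Complex projective space `ℙⁿ`: the lines through the origin of `ℂⁿ⁺¹`. -/
abbrev CP (n : ℕ) : Type := ℙ ℂ (Fin (n + 1) → ℂ)

/-- The standard topology of `ℙⁿ`: the quotient topology from `ℂⁿ⁺¹ \ {0}`. -/
instance instTopologicalSpaceCP (n : ℕ) : TopologicalSpace (CP n) :=
  inferInstanceAs (TopologicalSpace
    (Quotient (projectivizationSetoid ℂ (Fin (n + 1) → ℂ))))

/-- The Fubini–Study distance on `ℙⁿ`: the Hermitian angle between two complex lines,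
`arccos (|⟨u, v⟩| / (‖u‖ ‖v‖))` with the Euclidean norm. It does not depend on the chosen
representatives and induces the standard topology. -/
def fubiniStudyDist {n : ℕ} (p q : CP n) : ℝ :=
  Real.arccos (‖inner ℂ (WithLp.toLp 2 p.rep) (WithLp.toLp 2 q.rep)‖ /
    (‖WithLp.toLp 2 p.rep‖ * ‖WithLp.toLp 2 q.rep‖))

/-! ### Projective manifolds and affine algebraic Riemann surfaces -/

/-- The values at `v` of a tuple of polynomials, as a vector. -/
def evalVec {σ τ : Type*} (P : τ → MvPolynomial σ ℂ) (v : σ → ℂ) : τ → ℂ :=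
  fun i => MvPolynomial.eval v (P i)

/-- The gradient of a polynomial at the point `v`. -/
def gradAt {σ : Type*} (g : MvPolynomial σ ℂ) (v : σ → ℂ) : σ → ℂ :=
  fun i => MvPolynomial.eval v (MvPolynomial.pderiv i g)

/-- `X ⊆ ℙⁿ` is a closed algebraic subset: the common zero set of a family of homogeneous
polynomials. -/
def IsProjectiveAlgebraicSet {n : ℕ} (X : Set (CP n)) : Prop :=
  ∃ S : Set (MvPolynomial (Fin (n + 1)) ℂ),
    (∀ g ∈ S, ∃ d : ℕ, g.IsHomogeneous d) ∧
    X = {p | ∀ g ∈ S, MvPolynomial.eval p.rep g = 0}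

/-- `X ⊆ ℙⁿ` is a (not necessarily connected) projective manifold: a closed algebraic subset that
is smooth, that is, near each of its points it is the zero set of finitely many homogeneous
polynomials with linearly independent differentials at that point. -/
structure IsProjectiveManifold {n : ℕ} (X : Set (CP n)) : Prop where
  algebraic : IsProjectiveAlgebraicSet X
  smooth : ∀ p ∈ X, ∃ (c : ℕ) (g : Fin c → MvPolynomial (Fin (n + 1)) ℂ),
    (∀ j, ∃ d : ℕ, (g j).IsHomogeneous d) ∧
    (∀ᶠ q in 𝓝 p, q ∈ X ↔ ∀ j, MvPolynomial.eval q.rep (g j) = 0) ∧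
    LinearIndependent ℂ (fun j => gradAt (g j) p.rep)

/-- `R ⊆ ℂᵐ⁺¹` is an affine algebraic Riemann surface: a closed affine algebraic set that is
connected and smooth of dimension one, that is, near each of its points it is the zero set of
`m` polynomials with linearly independent differentials at that point. -/
structure IsAffineRiemannSurface {m : ℕ} (R : Set (Fin (m + 1) → ℂ)) : Prop where
  algebraic : ∃ S : Set (MvPolynomial (Fin (m + 1)) ℂ),
    R = {x | ∀ g ∈ S, MvPolynomial.eval x g = 0}
  connected : IsConnected R
  smooth : ∀ x ∈ R, ∃ g : Fin m → MvPolynomial (Fin (m + 1)) ℂ,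
    (∀ᶠ y in 𝓝 x, y ∈ R ↔ ∀ j, MvPolynomial.eval y (g j) = 0) ∧
    LinearIndependent ℂ (fun j => gradAt (g j) x)

/-! ### Morphisms and holomorphic maps -/

/-- `F : R → X ⊆ ℙⁿ`, with `R` an affine algebraic subset, is a morphism of algebraic varieties:
around every point it is given by a tuple of polynomials, used as homogeneous coordinates,
on the Zariski neighbourhood where they do not all vanish. -/
def IsAffineMorphism {m n : ℕ} {R : Set (Fin m → ℂ)} {X : Set (CP n)} (F : R → X) : Prop :=
  ∀ x : R, ∃ P : Fin (n + 1) → MvPolynomial (Fin m) ℂ,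
    evalVec P x ≠ 0 ∧
    ∀ (y : R) (hy : evalVec P y ≠ 0), (F y : CP n) = Projectivization.mk ℂ (evalVec P y) hy

/-- `φ : ℙᵐ → ℙⁿ` is a morphism of algebraic varieties: around every point it is given, in
homogeneous coordinates, by a tuple of homogeneous polynomials of the same degree, on the Zariski
neighbourhood where they do not all vanish. -/
def IsProjectiveMorphism {m n : ℕ} (φ : CP m → CP n) : Prop :=
  ∀ t : CP m, ∃ (d : ℕ) (P : Fin (n + 1) → MvPolynomial (Fin (m + 1)) ℂ),
    (∀ i, (P i).IsHomogeneous d) ∧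
    evalVec P t.rep ≠ 0 ∧
    ∀ (s : CP m) (hs : evalVec P s.rep ≠ 0),
      φ s = Projectivization.mk ℂ (evalVec P s.rep) hs

/-- `f : R → X ⊆ ℙⁿ` is holomorphic at `x`: near `x` it is given, in homogeneous coordinates, by
the restriction to `R` of a holomorphic map from a neighbourhood of `x` in the ambient affine
space to `ℂⁿ⁺¹ \ {0}`. -/
def HolomorphicAt {m n : ℕ} {R : Set (Fin m → ℂ)} {X : Set (CP n)} (f : R → X) (x : R) : Prop :=
  ∃ g : (Fin m → ℂ) → (Fin (n + 1) → ℂ), AnalyticAt ℂ g x ∧ g x ≠ 0 ∧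
    ∀ᶠ y : R in 𝓝 x, ∃ hy : g y ≠ 0, (f y : CP n) = Projectivization.mk ℂ (g y) hy

/-- `f` is holomorphic on a neighbourhood of `K` in `R`. -/
def HolomorphicNear {m n : ℕ} {R : Set (Fin m → ℂ)} {X : Set (CP n)} (f : R → X)
    (K : Set R) : Prop :=
  ∃ U : Set R, IsOpen U ∧ K ⊆ U ∧ ∀ x ∈ U, HolomorphicAt f x

/-- `F` and `f` agree to order `k` at `a`: in an affine chart of `ℙⁿ` around the common value,
all coordinates of `F` and `f` differ by `o(|y - a|ᵏ)` as `y → a`, so that their Taylor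
expansions at `a` coincide up to order `k`. -/
def AgreeToOrder {m n : ℕ} {R : Set (Fin m → ℂ)} {X : Set (CP n)} (F f : R → X) (k : ℕ)
    (a : R) : Prop :=
  ∃ i : Fin (n + 1), (F a : CP n).rep i ≠ 0 ∧ (f a : CP n).rep i ≠ 0 ∧
    ∀ j : Fin (n + 1),
      (fun y : R => (F y : CP n).rep j / (F y : CP n).rep i
        - (f y : CP n).rep j / (f y : CP n).rep i)
      =o[𝓝 a] fun y : R => ‖(y : Fin m → ℂ) - a‖ ^ k

/-! ### The algebraic Oka-1 property and rational connectedness -/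

/-- A Runge compact set in a surface: a compact set whose complement has no relatively compact
connected components. -/
def IsRungeCompact {S : Type*} [TopologicalSpace S] (K : Set S) : Prop :=
  IsCompact K ∧ ∀ x ∈ Kᶜ, ¬ IsCompact (closure (connectedComponentIn Kᶜ x))

/-- The algebraic Oka-1 property (aOka-1) of an algebraic manifold `X ⊆ ℙⁿ`. -/
def IsAOkaOne {n : ℕ} (X : Set (CP n)) : Prop :=
  ∀ (m : ℕ) (R : Set (Fin (m + 1) → ℂ)), IsAffineRiemannSurface R →
  ∀ K : Set R, IsRungeCompact K →
  ∀ A : Set R, A.Finite → A ⊆ K →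
  ∀ f : C(R, X), HolomorphicNear f K →
  ∀ ε : ℝ, 0 < ε →
  ∀ k : ℕ, 1 ≤ k →
    ∃ F : C(R, X), IsAffineMorphism F ∧ F.Homotopic f ∧
      (∀ p ∈ K, fubiniStudyDist (F p : CP n) (f p : CP n) < ε) ∧
      ∀ a ∈ A, AgreeToOrder F f k a

/-- `X ⊆ ℙⁿ` is rationally connected: it is connected and any two of its points lie in the image
of a morphism `ℙ¹ → X`. -/
def IsRationallyConnected {n : ℕ} (X : Set (CP n)) : Prop :=
  IsConnected X ∧ ∀ p ∈ X, ∀ q ∈ X, ∃ φ : CP 1 → CP n,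
    IsProjectiveMorphism φ ∧ (∀ t, φ t ∈ X) ∧ p ∈ Set.range φ ∧ q ∈ Set.range φ

end

/-! ### Evaluation of homogeneous polynomials and points of projective space -/

/-! Smoothness makes `X` locally path connected, so two points `p`, `q` of one component are joined
by a path. Composing it with a function of the real part gives a continuous map from the affine line
ℂ to `X`, locally constant near 0 and 1, hence holomorphic near the Runge compact set `{0, 1}`. The
aOka-1 property with `K = A = {0, 1}` then yields a morphism ℂ → `X` sending 0 to `p` and 1 to `q`;
only interpolation is needed, not approximation or homotopy (`IsAOkaOne.exists_affineMorphism`).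

Such a morphism is given by one tuple of polynomials without common zero, and homogenizing the tuple
extends it to ℙ¹. The extension stays in `X` because `X` is closed, and in one component because its
image is connected (`IsAffineMorphism.exists_extension`). -/

theorem MvPolynomial.IsHomogeneous.eval_smul {σ : Type*} [Fintype σ] {g : MvPolynomial σ ℂ} {d : ℕ}
    (hg : g.IsHomogeneous d) (c : ℂ) (v : σ → ℂ) :
    MvPolynomial.eval (c • v) g = c ^ d * MvPolynomial.eval v g := by
  rw [MvPolynomial.eval_eq', MvPolynomial.eval_eq', Finset.mul_sum]
  refine Finset.sum_congr rfl fun e he => ?_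
  have h : ∑ i, e i = d := by
    rw [← Finsupp.degree_eq_sum]
    rw [Finsupp.degree_eq_weight_one]
    exact hg (MvPolynomial.mem_support_iff.mp he)
  simp only [Pi.smul_apply, smul_eq_mul, mul_pow, Finset.prod_mul_distrib,
    Finset.prod_pow_eq_pow_sum, h]
  ring

theorem eval_rep_mk_eq_zero_iff {n d : ℕ} {g : MvPolynomial (Fin (n + 1)) ℂ}
    (hg : g.IsHomogeneous d) {v : Fin (n + 1) → ℂ} (hv : v ≠ 0) :
    MvPolynomial.eval (Projectivization.mk ℂ v hv).rep g = 0 ↔ MvPolynomial.eval v g = 0 := by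
  obtain ⟨a, ha⟩ := Projectivization.exists_smul_eq_mk_rep ℂ v hv
  rw [← ha, Units.smul_def, hg.eval_smul]
  simp

theorem continuous_evalVec {σ τ : Type*} (P : τ → MvPolynomial σ ℂ) : Continuous (evalVec P) :=
  continuous_pi fun i => (P i).continuous_eval

theorem continuous_projectivizationMk (n : ℕ) :
    Continuous (fun v : {v : Fin (n + 1) → ℂ // v ≠ 0} =>
      (Projectivization.mk ℂ v.1 v.2 : CP n)) :=
  continuous_quotient_mk'

/-- The saturation of an open set is the union of its scalings, each open. -/
theorem isOpenMap_projectivizationMk (n : ℕ) :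
    IsOpenMap (fun v : {v : Fin (n + 1) → ℂ // v ≠ 0} =>
      (Projectivization.mk ℂ v.1 v.2 : CP n)) := by
  intro U hU
  have hq : IsQuotientMap (fun v : {v : Fin (n + 1) → ℂ // v ≠ 0} =>
      (Projectivization.mk ℂ v.1 v.2 : CP n)) := isQuotientMap_quotient_mk'
  rw [← hq.isOpen_preimage]
  have h : (fun v : {v : Fin (n + 1) → ℂ // v ≠ 0} =>
      (Projectivization.mk ℂ v.1 v.2 : CP n)) ⁻¹' ((fun v : {v : Fin (n + 1) → ℂ // v ≠ 0} =>
      (Projectivization.mk ℂ v.1 v.2 : CP n)) '' U) =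
      ⋃ a : ℂˣ, (fun v : {v : Fin (n + 1) → ℂ // v ≠ 0} =>
        (⟨a • v.1, (smul_ne_zero_iff_ne a).2 v.2⟩ : {v : Fin (n + 1) → ℂ // v ≠ 0})) ⁻¹' U := by
    ext v
    simp only [Set.mem_preimage, Set.mem_image, Set.mem_iUnion, Projectivization.mk_eq_mk_iff]
    constructor
    · rintro ⟨w, hw, a, ha⟩
      exact ⟨a, by simpa [ha] using hw⟩
    · rintro ⟨a, ha⟩
      exact ⟨_, ha, a, rfl⟩
  rw [h]
  refine isOpen_iUnion fun a => hU.preimage ?_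
  exact Continuous.subtype_mk (continuous_subtype_val.const_smul a) _

/-! ### Local path connectedness of projective manifolds -/

/-- The differential of a polynomial at a point. -/
noncomputable def MvPolynomial.differential {σ : Type*} [Fintype σ] (g : MvPolynomial σ ℂ)
    (v : σ → ℂ) : (σ → ℂ) →L[ℂ] ℂ :=
  ∑ i, gradAt g v i • ContinuousLinearMap.proj i

theorem MvPolynomial.hasStrictFDerivAt_eval {σ : Type*} [Fintype σ] (g : MvPolynomial σ ℂ)
    (v : σ → ℂ) :
    HasStrictFDerivAt (fun w => MvPolynomial.eval w g) (g.differential v) v := by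
  classical
  induction g using MvPolynomial.induction_on with
  | C a =>
    simp only [MvPolynomial.eval_C]
    refine (hasStrictFDerivAt_const (𝕜 := ℂ) a v).congr_fderiv ?_
    ext w
    simp [MvPolynomial.differential, gradAt]
  | add p q hp hq =>
    simp only [map_add]
    refine (hp.add hq).congr_fderiv ?_
    ext w
    simp [MvPolynomial.differential, gradAt, add_mul, Finset.sum_add_distrib]
  | mul_X p i hp =>
    simp only [map_mul, MvPolynomial.eval_X]
    refine (hp.mul (hasStrictFDerivAt_apply (𝕜 := ℂ) i v)).congr_fderiv ?_
    ext w
    simp [MvPolynomial.differential, gradAt, add_mul, Finset.sum_add_distrib,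
      MvPolynomial.pderiv_X, Pi.single_apply, Finset.mul_sum, mul_assoc, apply_ite]

/-- The implicit function theorem straightens the zero locus to the slice `z.1 = 0` of a ball, which
is convex; the path is the preimage of a segment. -/
theorem exists_joinedIn_zeroLocus {c n : ℕ} (g : Fin c → MvPolynomial (Fin n) ℂ)
    (v₀ : Fin n → ℂ) (h₀ : ∀ j, MvPolynomial.eval v₀ (g j) = 0)
    (hli : LinearIndependent ℂ fun j => gradAt (g j) v₀) {N : Set (Fin n → ℂ)} (hN : N ∈ 𝓝 v₀) :
    ∀ᶠ v in 𝓝 v₀, (∀ j, MvPolynomial.eval v (g j) = 0) →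
      JoinedIn (N ∩ {w | ∀ j, MvPolynomial.eval w (g j) = 0}) v₀ v := by
  classical
  let G : (Fin n → ℂ) → Fin c → ℂ := fun v j => MvPolynomial.eval v (g j)
  let G' : (Fin n → ℂ) →L[ℂ] Fin c → ℂ :=
    ContinuousLinearMap.pi fun j => (g j).differential v₀
  have hG : HasStrictFDerivAt G G' v₀ :=
    hasStrictFDerivAt_pi.2 fun j => (g j).hasStrictFDerivAt_eval v₀
  -- Independent gradients mean that the Jacobian has full row rank.
  have hG' : G'.range = ⊤ := by
    let M : Matrix (Fin c) (Fin n) ℂ := Matrix.of fun j => gradAt (g j) v₀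
    have hM : G'.range = M.mulVecLin.range := by
      congr 1
      ext1 w
      ext j
      simp [G', M, MvPolynomial.differential, Matrix.mulVec, dotProduct]
    rw [hM]
    apply Submodule.eq_top_of_finrank_eq
    have : M.rank = Fintype.card (Fin c) := LinearIndependent.rank_matrix hli
    rw [Matrix.rank] at this
    simpa using this
  let Φ := hG.implicitToOpenPartialHomeomorph G G' hG'
  have hfst : ∀ v, (Φ v).1 = G v := hG.implicitToOpenPartialHomeomorph_fst hG'
  have hG₀ : G v₀ = 0 := funext h₀
  have hΦ₀ : Φ v₀ = (0, 0) := by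
    rw [← hG₀]; exact hG.implicitToOpenPartialHomeomorph_self hG'
  have hs : v₀ ∈ Φ.source := hG.mem_implicitToOpenPartialHomeomorph_source hG'
  have hT : Φ.target ∩ Φ.symm ⁻¹' N ∈ 𝓝 (Φ v₀) := by
    refine Filter.inter_mem (Φ.open_target.mem_nhds (Φ.map_source hs)) ?_
    exact (Φ.tendsto_symm hs) hN
  obtain ⟨r, hr, hball⟩ := Metric.mem_nhds_iff.1 hT
  filter_upwards [(Φ.continuousAt hs) (Metric.ball_mem_nhds _ hr), Φ.open_source.mem_nhds hs]
    with v hv hvs hv0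
  have hseg : JoinedIn (Metric.ball (Φ v₀) r ∩ {z | z.1 = 0}) (Φ v₀) (Φ v) := by
    apply JoinedIn.of_segment_subset
    apply Convex.segment_subset
    · exact (convex_ball _ _).inter
        (Convex.is_linear_preimage (convex_singleton (𝕜 := ℝ) (0 : Fin c → ℂ))
          (f := Prod.fst) ⟨fun _ _ => rfl, fun _ _ => rfl⟩)
    · exact ⟨Metric.mem_ball_self hr, by simp [hΦ₀]⟩
    · exact ⟨hv, (hfst v).trans (funext hv0)⟩
  have := hseg.map_continuousOn (f := Φ.symm)
    (Φ.continuousOn_symm.mono fun z hz => (hball hz.1).1)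
  rw [Φ.left_inv hs, Φ.left_inv hvs] at this
  refine this.mono ?_
  rintro _ ⟨z, ⟨hz, hz0⟩, rfl⟩
  refine ⟨(hball hz).2, fun j => ?_⟩
  have h1 := hfst (Φ.symm z)
  rw [Φ.right_inv (hball hz).1, hz0] at h1
  exact (congrFun h1 j).symm

/-- The path is built in the cone over `X` in ℂⁿ⁺¹ ∖ {0}, where the local equations are polynomial,
and then projected. -/
theorem IsProjectiveManifold.eventually_joinedIn {n : ℕ} {X : Set (CP n)}
    (hX : IsProjectiveManifold X) {p : CP n} (hp : p ∈ X) :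
    ∀ᶠ q in 𝓝 p, q ∈ X → JoinedIn X p q := by
  obtain ⟨c, g, hg, hev, hli⟩ := hX.smooth p hp
  let V := {v : Fin (n + 1) → ℂ // v ≠ 0}
  let π : V → CP n := fun v => Projectivization.mk ℂ v.1 v.2
  have hπ : Continuous π := continuous_projectivizationMk n
  let v₀ : V := ⟨p.rep, p.rep_nonzero⟩
  have hv₀ : π v₀ = p := p.mk_rep
  have hπg : ∀ (v : V) j, MvPolynomial.eval (π v).rep (g j) = 0 ↔
      MvPolynomial.eval v.1 (g j) = 0 := fun v j =>
    eval_rep_mk_eq_zero_iff (hg j).choose_spec v.2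
  have hV : IsOpenEmbedding (Subtype.val : V → Fin (n + 1) → ℂ) :=
    (isOpen_ne (X := Fin (n + 1) → ℂ) (x := 0)).isOpenEmbedding_subtypeVal
  have hevV : ∀ᶠ v in 𝓝 v₀, π v ∈ X ↔ ∀ j, MvPolynomial.eval (π v).rep (g j) = 0 :=
    hπ.continuousAt.eventually (by rwa [hv₀])
  have h₀ : ∀ j, MvPolynomial.eval v₀.1 (g j) = 0 := hev.self_of_nhds.1 hp
  -- The `g j` cut out `X` only near `p`, so the path must stay over that neighbourhood, which also
  -- avoids the origin.
  have hjoin := exists_joinedIn_zeroLocus g v₀.1 h₀ hli (hV.isOpenMap.image_mem_nhds hevV)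
  have hjV : ∀ᶠ v : V in 𝓝 v₀, π v ∈ X → JoinedIn X p (π v) := by
    filter_upwards [continuous_subtype_val.continuousAt.eventually hjoin, hevV] with v hv hvX hmem
    obtain ⟨γ, hγ⟩ := hv fun j => (hπg v j).1 (hvX.1 hmem j)
    have hne : ∀ t, γ t ≠ 0 := by
      intro t
      obtain ⟨w, -, hw⟩ := (hγ t).1
      exact hw ▸ w.2
    have hγV : JoinedIn (π ⁻¹' X) v₀ v := by
      refine ⟨⟨⟨fun t => ⟨γ t, hne t⟩, γ.continuous.subtype_mk _⟩, by simp, by simp⟩,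
        fun t => ?_⟩
      obtain ⟨⟨w, hw, hwt⟩, hz⟩ := hγ t
      have hwt' : w = ⟨γ t, hne t⟩ := Subtype.ext hwt
      change π ⟨γ t, hne t⟩ ∈ X
      rw [← hwt']
      refine hw.2 fun j => (hπg w j).2 ?_
      rw [hwt]
      exact hz j
    have := (hγV.map hπ)
    rw [hv₀] at this
    exact this.mono (Set.image_preimage_subset _ _)
  rw [← hv₀]
  have := (isOpenMap_projectivizationMk n).image_mem_nhds hjV
  filter_upwards [this]
  rintro _ ⟨v, hv, rfl⟩ hmem
  exact hv₀ ▸ hv hmem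

/-- Being joined to `p` is a locally constant property on `X`, so it cannot change within a
connected set. -/
theorem IsProjectiveManifold.joinedIn_of_mem_connectedComponentIn {n : ℕ} {X : Set (CP n)}
    (hX : IsProjectiveManifold X) {x p q : CP n}
    (hp : p ∈ connectedComponentIn X x) (hq : q ∈ connectedComponentIn X x) :
    JoinedIn X p q := by
  have hpX := connectedComponentIn_subset X x hp
  have hC : IsPreconnected (connectedComponentIn X x) := isPreconnected_connectedComponentIn
  let U : Set (CP n) := {r | ∀ᶠ s in 𝓝 r, s ∈ X → JoinedIn X p s}
  let W : Set (CP n) := {r | ∀ᶠ s in 𝓝 r, s ∈ X → ¬ JoinedIn X p s}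
  have hU : IsOpen U := isOpen_setOfPred_eventually_nhds
  have hW : IsOpen W := isOpen_setOfPred_eventually_nhds
  have hcov : connectedComponentIn X x ⊆ U ∪ W := by
    intro r hr
    have hrX := connectedComponentIn_subset X x hr
    by_cases h : JoinedIn X p r
    · left
      filter_upwards [hX.eventually_joinedIn hrX] with s hs hsX using h.trans (hs hsX)
    · right
      filter_upwards [hX.eventually_joinedIn hrX] with s hs hsX hps
      exact h (hps.trans (hs hsX).symm)
  by_contra hcon
  obtain ⟨r, hr, hrU, hrW⟩ := hC U W hU hW hcov
    ⟨p, hp, hX.eventually_joinedIn hpX⟩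
    ⟨q, hq, (hcov hq).resolve_left fun h =>
      hcon (h.self_of_nhds (connectedComponentIn_subset X x hq))⟩
  have hrX := connectedComponentIn_subset X x hr
  exact hrW.self_of_nhds hrX (hrU.self_of_nhds hrX)

/-! ### Extension of morphisms from the affine line to the projective line -/

/-- A polynomial in one variable, indexed by `Fin 1`, as a univariate polynomial. -/
noncomputable def MvPolynomial.toUnivariate (P : MvPolynomial (Fin 1) ℂ) : Polynomial ℂ :=
  MvPolynomial.aeval (fun _ => Polynomial.X) P

theorem MvPolynomial.eval_toUnivariate (P : MvPolynomial (Fin 1) ℂ) (z : Fin 1 → ℂ) :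
    P.toUnivariate.eval (z 0) = MvPolynomial.eval z P := by
  have hz : z = fun _ => z 0 := _root_.funext fun i => congrArg z (Subsingleton.elim i 0)
  induction P using MvPolynomial.induction_on with
  | C a => simp [MvPolynomial.toUnivariate]
  | add p q hp hq =>
    simp only [MvPolynomial.toUnivariate, map_add, Polynomial.eval_add] at *
    rw [hp, hq]
  | mul_X p i hp =>
    simp only [MvPolynomial.toUnivariate, map_mul, Polynomial.eval_mul, MvPolynomial.aeval_X,
      Polynomial.eval_X, MvPolynomial.eval_X] at *
    rw [hp, Subsingleton.elim i 0]

/-- The common factors of a nonzero tuple of polynomials can be divided out. -/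
theorem exists_mul_eq_no_common_root {n : ℕ} (p : Fin (n + 1) → Polynomial ℂ) :
    ∃ (h : Polynomial ℂ) (q : Fin (n + 1) → Polynomial ℂ), (∀ i, p i = h * q i) ∧
      ∀ z, ∃ i, (q i).eval z ≠ 0 := by
  classical
  let : NormalizedGCDMonoid (Polynomial ℂ) :=
    (UniqueFactorizationMonoid.toNormalizedGCDMonoid _)
  obtain ⟨q, hq, hgcd⟩ := Finset.univ.extract_gcd p Finset.univ_nonempty
  refine ⟨_, q, fun i => hq i (Finset.mem_univ i), fun z => ?_⟩
  by_contra! hz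
  have hdvd : Polynomial.X - Polynomial.C z ∣ Finset.univ.gcd q :=
    Finset.dvd_gcd fun i _ => Polynomial.dvd_iff_isRoot.2 (hz i)
  rw [hgcd] at hdvd
  exact Polynomial.not_isUnit_X_sub_C z (isUnit_of_dvd_one hdvd)

theorem Polynomial.eval_homogenize_of_eq_zero {p : Polynomial ℂ} {d : ℕ}
    (x : Fin 2 → ℂ) (hx : x 1 = 0) :
    MvPolynomial.eval x (p.homogenize d) = p.coeff d * x 0 ^ d := by
  simp only [Polynomial.homogenize, MvPolynomial.eval_sum]
  rw [Finset.sum_eq_single (d, 0)]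
  · simp [MvPolynomial.eval_monomial, Finsupp.update_eq_add_single]
  · rintro ⟨k, l⟩ hkl hne
    have hl : l ≠ 0 := by
      rintro rfl
      simp at hkl
      exact hne (by simp [hkl])
    simp [MvPolynomial.eval_monomial, Finsupp.update_eq_add_single, hx, hl]
  · simp

/-- Homogenizing to the maximal degree prevents a common zero at infinity: there the entry of
maximal degree takes its leading coefficient times a nonzero power. -/
theorem exists_homogeneous_tuple {n : ℕ} (q : Fin (n + 1) → Polynomial ℂ)
    (hq : ∀ z, ∃ i, (q i).eval z ≠ 0) :
    ∃ (d : ℕ) (H : Fin (n + 1) → MvPolynomial (Fin 2) ℂ), (∀ i, (H i).IsHomogeneous d) ∧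
      (∀ x, x ≠ 0 → evalVec H x ≠ 0) ∧
      ∀ x : Fin 2 → ℂ, x 1 ≠ 0 →
        evalVec H x = x 1 ^ d • fun i => (q i).eval (x 0 / x 1) := by
  obtain ⟨i₀, -, hi₀⟩ := Finset.univ.exists_max_image (fun i => (q i).natDegree)
    Finset.univ_nonempty
  have hdeg : ∀ i, (q i).natDegree ≤ (q i₀).natDegree := fun i => hi₀ i (Finset.mem_univ i)
  have haff : ∀ x : Fin 2 → ℂ, x 1 ≠ 0 →
      evalVec (fun i => (q i).homogenize (q i₀).natDegree) x =
        x 1 ^ (q i₀).natDegree • fun i => (q i).eval (x 0 / x 1) := by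
    intro x hx
    ext i
    simp [evalVec, Polynomial.eval_homogenize (hdeg i) x hx, mul_comm]
  refine ⟨(q i₀).natDegree, fun i => (q i).homogenize _,
    fun i => Polynomial.isHomogeneous_homogenize _, fun x hx h0 => ?_, haff⟩
  by_cases hx1 : x 1 = 0
  · have hx0 : x 0 ≠ 0 := by
      intro hx0
      exact hx (by ext i; fin_cases i <;> simp [hx0, hx1])
    have hcoeff : ∀ i, (q i).coeff (q i₀).natDegree = 0 := by
      intro i
      have := congrFun h0 i
      simpa [evalVec, Polynomial.eval_homogenize_of_eq_zero x hx1, hx0]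
        using this
    -- This forces the maximal degree to be 0, so the vanishing coefficients are the values at 0,
    -- contradicting `hq 0`.
    have hzero : q i₀ = 0 := Polynomial.leadingCoeff_eq_zero.1 (hcoeff i₀)
    obtain ⟨i, hi⟩ := hq 0
    apply hi
    rw [← Polynomial.coeff_zero_eq_eval_zero]
    simpa [hzero] using hcoeff i
  · rw [haff x hx1, smul_eq_zero_iff_right (pow_ne_zero _ hx1)] at h0
    obtain ⟨i, hi⟩ := hq (x 0 / x 1)
    exact hi (congrFun h0 i)

/-- A morphism from the affine line is globally given by polynomials without common zeros. -/
theorem IsAffineMorphism.exists_polynomials {n : ℕ} {X : Set (CP n)}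
    {F : ↥(Set.univ : Set (Fin 1 → ℂ)) → X} (hF : IsAffineMorphism F) :
    ∃ q : Fin (n + 1) → Polynomial ℂ, (∀ z, ∃ i, (q i).eval z ≠ 0) ∧
      ∀ (y : (Set.univ : Set (Fin 1 → ℂ))) (hy : (fun i => (q i).eval (y.1 0)) ≠ 0),
        (F y : CP n) = Projectivization.mk ℂ (fun i => (q i).eval (y.1 0)) hy := by
  have loc : ∀ x : (Set.univ : Set (Fin 1 → ℂ)), ∃ P : Fin (n + 1) → Polynomial ℂ,
      (fun i => (P i).eval (x.1 0)) ≠ 0 ∧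
      ∀ (y : (Set.univ : Set (Fin 1 → ℂ))) (hy : (fun i => (P i).eval (y.1 0)) ≠ 0),
        (F y : CP n) = Projectivization.mk ℂ (fun i => (P i).eval (y.1 0)) hy := by
    intro x
    obtain ⟨P, hPx, hP⟩ := hF x
    have hev : ∀ y : Fin 1 → ℂ, evalVec P y = fun i => (P i).toUnivariate.eval (y 0) :=
      fun y => funext fun i => ((P i).eval_toUnivariate y).symm
    refine ⟨fun i => (P i).toUnivariate, by rwa [hev] at hPx, fun y hy => ?_⟩
    rw [hP y (by rwa [hev])]
    congr 1
    exact hev _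
  obtain ⟨p, hp0, hp⟩ := loc ⟨0, trivial⟩
  obtain ⟨h, q, hpq, hq⟩ := exists_mul_eq_no_common_root p
  have hh : h ≠ 0 := by
    rintro rfl
    exact hp0 (by ext i; simp [hpq])
  refine ⟨q, hq, fun x hx => ?_⟩
  obtain ⟨P, hPx, hP⟩ := loc x
  -- Both tuples represent `F` away from the zeros of `h * P k`. Multiplying by this factor makes
  -- the identity hold at every point, and it cancels in the domain ℂ[z].
  have hcross : ∀ i j, P i * q j = P j * q i := by
    intro i j
    obtain ⟨k, hk⟩ := Function.ne_iff.1 hPx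
    have hPk : P k ≠ 0 := by
      rintro hPk
      exact hk (by simp [hPk])
    have hz : h * P k * (P i * q j - P j * q i) = 0 := by
      apply Polynomial.funext
      intro z
      by_cases hz : (h * P k).eval z = 0
      · rw [Polynomial.eval_mul, hz]; simp
      rw [Polynomial.eval_mul, ← ne_eq, mul_ne_zero_iff] at hz
      have hPz : (fun i => (P i).eval z) ≠ 0 := Function.ne_iff.2 ⟨k, hz.2⟩
      have hpz : (fun i => (p i).eval z) ≠ 0 := by
        obtain ⟨l, hl⟩ := hq z
        exact Function.ne_iff.2 ⟨l, by simp [hpq, hl, hz.1]⟩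
      have := (hP ⟨fun _ => z, trivial⟩ hPz).symm.trans (hp ⟨fun _ => z, trivial⟩ hpz)
      rw [Projectivization.mk_eq_mk_iff'] at this
      obtain ⟨a, ha⟩ := this
      have hai : ∀ i, (P i).eval z = a * (h.eval z * (q i).eval z) := fun i => by
        simpa [hpq] using (congrFun ha i).symm
      simp only [Polynomial.eval_mul, Polynomial.eval_sub, Polynomial.eval_zero, hai]
      ring
    have := (mul_eq_zero.1 hz).resolve_left (mul_ne_zero hh hPk)
    exact sub_eq_zero.1 this
  rw [hP x hPx, Projectivization.mk_eq_mk_iff']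
  obtain ⟨k, hk⟩ := Function.ne_iff.1 hx
  refine ⟨(P k).eval (x.1 0) / (q k).eval (x.1 0), funext fun i => ?_⟩
  have := congrArg (Polynomial.eval (x.1 0)) (hcross i k)
  simp only [Polynomial.eval_mul] at this
  simp only [Pi.smul_apply, smul_eq_mul]
  simp only [Pi.zero_apply] at hk
  field_simp
  linear_combination -this

theorem IsProjectiveAlgebraicSet.exists_mk_mem_iff {n : ℕ} {X : Set (CP n)}
    (hX : IsProjectiveAlgebraicSet X) : ∃ S : Set (MvPolynomial (Fin (n + 1)) ℂ),
      ∀ (v : Fin (n + 1) → ℂ) (hv : v ≠ 0),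
        (Projectivization.mk ℂ v hv : CP n) ∈ X ↔ ∀ g ∈ S, MvPolynomial.eval v g = 0 := by
  obtain ⟨S, hS, rfl⟩ := hX
  exact ⟨S, fun v hv => forall₂_congr fun g hg => eval_rep_mk_eq_zero_iff (hS g hg).choose_spec hv⟩

/-- A morphism from the affine line to a closed algebraic subset of `ℙⁿ` extends to `ℙ¹`; the
extension takes values in a connected component. -/
theorem IsAffineMorphism.exists_extension {n : ℕ} {X : Set (CP n)}
    (hX : IsProjectiveAlgebraicSet X)
    {F : ↥(Set.univ : Set (Fin 1 → ℂ)) → X} (hF : IsAffineMorphism F) :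
    ∃ φ : CP 1 → CP n, IsProjectiveMorphism φ ∧ (∀ y, (F y : CP n) ∈ Set.range φ) ∧
      ∀ y t, φ t ∈ connectedComponentIn X (F y) := by
  obtain ⟨q, hq, hFq⟩ := hF.exists_polynomials
  obtain ⟨d, H, hH, hH0, hHq⟩ := exists_homogeneous_tuple q hq
  obtain ⟨S, hS⟩ := hX.exists_mk_mem_iff
  have hq0 : ∀ z, (fun i => (q i).eval z) ≠ 0 := fun z => Function.ne_iff.2 (hq z)
  let ψ : {v : Fin 2 → ℂ // v ≠ 0} → CP n :=
    fun v => Projectivization.mk ℂ (evalVec H v.1) (hH0 v.1 v.2)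
  have hψ : Continuous ψ := (continuous_projectivizationMk n).comp
    (((continuous_evalVec H).comp continuous_subtype_val).subtype_mk fun v => hH0 v.1 v.2)
  have hψF : ∀ v : {v : Fin 2 → ℂ // v ≠ 0}, v.1 1 ≠ 0 →
      ψ v = F ⟨fun _ => v.1 0 / v.1 1, trivial⟩ := by
    intro v hv
    rw [hFq _ (hq0 _), Projectivization.mk_eq_mk_iff']
    exact ⟨v.1 1 ^ d, (hHq v.1 hv).symm⟩
  -- Points at infinity are reached by density: with `v 0` fixed, the equations of `X` hold for all
  -- `t ≠ 0`, hence also at `t = 0`.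
  have hψX : ∀ v, ψ v ∈ X := by
    rintro ⟨v, hv⟩
    refine (hS _ _).2 fun g hg => ?_
    have hcl : IsClosed {w : Fin 2 → ℂ | MvPolynomial.eval (evalVec H w) g = 0} :=
      isClosed_eq (g.continuous_eval.comp (continuous_evalVec H)) continuous_const
    have hcl' : IsClosed {t : ℂ | MvPolynomial.eval (evalVec H ![v 0, t]) g = 0} :=
      hcl.preimage (f := fun t : ℂ => ![v 0, t]) (by fun_prop)
    have hsub : ({0}ᶜ : Set ℂ) ⊆ {t : ℂ | MvPolynomial.eval (evalVec H ![v 0, t]) g = 0} := by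
      intro t ht
      have ht' : (![v 0, t] : Fin 2 → ℂ) ≠ 0 := fun h => ht (by simpa using congrFun h 1)
      have := hψF ⟨![v 0, t], ht'⟩ (by simpa using ht)
      have hmem : ψ ⟨![v 0, t], ht'⟩ ∈ X := by rw [this]; exact (F _).2
      exact (hS _ (hH0 _ ht')).1 hmem g hg
    have huniv := hcl'.closure_subset_iff.2 hsub
    rw [(dense_compl_singleton (0 : ℂ)).closure_eq] at huniv
    have := huniv (Set.mem_univ (v 1))
    have hv' : ![v 0, v 1] = v := by ext i; fin_cases i <;> rfl
    simpa only [Set.mem_ofPred_eq, hv'] using this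
  have hconn : IsPreconnected (Set.range ψ) := by
    have : ConnectedSpace {v : Fin 2 → ℂ // v ≠ 0} := by
      apply isConnected_iff_connectedSpace.1
      apply isConnected_compl_singleton_of_one_lt_rank
      have : Module.finrank ℝ (Fin 2 → ℂ) = 4 := by
        rw [Module.finrank_pi_fintype]; simp
      rw [← Module.finrank_eq_rank, this]
      norm_num
    exact isPreconnected_range hψ
  have hψy : ∀ y, ψ ⟨![y.1 0, 1], fun h => one_ne_zero (congrFun h 1)⟩ = F y := by
    intro y
    rw [hψF _ (by simp)]
    congr 2
    ext i
    simp [Subsingleton.elim i 0]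
  -- All `H i` have the same degree, so `ψ` depends only on the line spanned by `v`.
  have hψrep : ∀ v : {v : Fin 2 → ℂ // v ≠ 0},
      ψ ⟨(Projectivization.mk ℂ v.1 v.2).rep, Projectivization.rep_nonzero _⟩ = ψ v := by
    intro v
    obtain ⟨a, ha⟩ := Projectivization.exists_smul_eq_mk_rep ℂ v.1 v.2
    refine (Projectivization.mk_eq_mk_iff' ..).2 ⟨(a : ℂ) ^ d, funext fun i => ?_⟩
    have := (hH i).eval_smul a v.1
    rw [← Units.smul_def, ha] at this
    exact this.symm
  refine ⟨fun t => ψ ⟨t.rep, t.rep_nonzero⟩, fun t => ⟨d, H, hH, hH0 _ t.rep_nonzero,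
    fun s hs => rfl⟩, fun y => ⟨_, (hψrep _).trans (hψy y)⟩, fun y t => ?_⟩
  have hsub := hconn.subset_connectedComponentIn ⟨_, hψy y⟩ (Set.range_subset_iff.2 hψX)
  exact hsub ⟨_, rfl⟩

/-! ### The affine line as a source of test maps -/

theorem isAffineRiemannSurface_univ :
    IsAffineRiemannSurface (Set.univ : Set (Fin (0 + 1) → ℂ)) where
  algebraic := ⟨∅, by simp⟩
  connected := isConnected_univ
  smooth x _ := ⟨Fin.elim0, by simp, linearIndependent_empty_type⟩

/-- The complement of a finite set in the real plane is connected, and its closure cannot be compact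
because ℂ is not. -/
theorem Set.Finite.isRungeCompact_univ {K : Set (Set.univ : Set (Fin 1 → ℂ))} (hK : K.Finite) :
    IsRungeCompact K := by
  refine ⟨hK.isCompact, fun x hx hcl => ?_⟩
  have hconn : IsPreconnected Kᶜ := by
    let e := Homeomorph.Set.univ (Fin 1 → ℂ)
    have hrank : 1 < Module.rank ℝ (Fin 1 → ℂ) := by
      have : Module.finrank ℝ (Fin 1 → ℂ) = 2 := by
        rw [Module.finrank_pi_fintype]; simp
      rw [← Module.finrank_eq_rank, this]
      norm_num
    have := ((hK.image e).countable.isConnected_compl_of_one_lt_rank hrank).isPreconnected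
    rw [← e.isPreconnected_image, e.image_compl]
    exact this
  rw [hconn.connectedComponentIn hx] at hcl
  have huniv : IsCompact (Set.univ : Set (Set.univ : Set (Fin 1 → ℂ))) := by
    refine (hcl.union hK.isCompact).of_isClosed_subset isClosed_univ fun y _ => ?_
    by_cases hy : y ∈ K
    · exact Or.inr hy
    · exact Or.inl (subset_closure hy)
  have := (Homeomorph.Set.univ (Fin 1 → ℂ)).isCompact_image.2 huniv
  rw [Set.image_univ_of_surjective (Homeomorph.surjective _)] at this
  exact noncompact_univ (Fin 1 → ℂ) this

theorem continuous_re_affineLine :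
    Continuous fun y : (Set.univ : Set (Fin 1 → ℂ)) => (y.1 0).re :=
  Complex.continuous_re.comp ((continuous_apply 0).comp continuous_subtype_val)

theorem HolomorphicAt.of_eventuallyEq_const {m n : ℕ} {R : Set (Fin m → ℂ)} {X : Set (CP n)}
    {f : R → X} {x : R} {p : X} (h : ∀ᶠ y in 𝓝 x, f y = p) : HolomorphicAt f x := by
  refine ⟨fun _ => p.1.rep, analyticAt_const, p.1.rep_nonzero, ?_⟩
  filter_upwards [h] with y hy
  exact ⟨p.1.rep_nonzero, by rw [hy, Projectivization.mk_rep]⟩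

theorem AgreeToOrder.apply_eq {m n : ℕ} {R : Set (Fin m → ℂ)} {X : Set (CP n)} {F f : R → X}
    {k : ℕ} (hk : 1 ≤ k) {a : R} (h : AgreeToOrder F f k a) : F a = f a := by
  obtain ⟨i, hFi, hfi, hj⟩ := h
  have hratio : ∀ j, (F a : CP n).rep j / (F a : CP n).rep i =
      (f a : CP n).rep j / (f a : CP n).rep i := by
    intro j
    have := ((hj j).def one_pos).self_of_nhds
    -- The little-o bound is read at `y = a` itself, where its right side vanishes since `k ≥ 1`.
    rw [sub_self, norm_zero, zero_pow (by omega), norm_zero, mul_zero] at this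
    exact sub_eq_zero.1 (norm_le_zero_iff.1 this)
  apply Subtype.ext
  rw [← Projectivization.mk_rep (F a : CP n), ← Projectivization.mk_rep (f a : CP n),
    Projectivization.mk_eq_mk_iff']
  refine ⟨(F a : CP n).rep i / (f a : CP n).rep i, funext fun j => ?_⟩
  have := hratio j
  simp only [Pi.smul_apply, smul_eq_mul]
  field_simp at this ⊢
  linear_combination -this

/-- Two points joined by a path in `X` are joined by a continuous map from the affine line that is
constant near `0` and near `1`. -/
theorem JoinedIn.exists_continuousMap_affineLine {n : ℕ} {X : Set (CP n)} {p q : CP n}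
    (h : JoinedIn X p q) : ∃ f : C((Set.univ : Set (Fin 1 → ℂ)), X),
      (∀ y, (y.1 0).re < 1 / 3 → (f y : CP n) = p) ∧
      ∀ y, 2 / 3 < (y.1 0).re → (f y : CP n) = q := by
  obtain ⟨γ, hγ⟩ := h
  -- The map `t ↦ 3t - 1` sends 1/3 to 0 and 2/3 to 1, beyond which `γ.extend` is constant.
  refine ⟨⟨fun y => ⟨γ.extend (3 * (y.1 0).re - 1), ?_⟩, ?_⟩, fun y hy => ?_, fun y hy => ?_⟩
  · exact hγ _
  · refine Continuous.subtype_mk (γ.continuous_extend.comp ?_) _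
    exact (continuous_re_affineLine.const_mul 3).sub continuous_const
  · exact γ.extend_of_le_zero (by linarith)
  · exact γ.extend_of_one_le (by linarith)

theorem IsAOkaOne.exists_affineMorphism {n : ℕ} {X : Set (CP n)} (hO : IsAOkaOne X) {p q : CP n}
    (h : JoinedIn X p q) : ∃ F : ↥(Set.univ : Set (Fin 1 → ℂ)) → X, IsAffineMorphism F ∧
      (F ⟨0, trivial⟩ : CP n) = p ∧ (F ⟨1, trivial⟩ : CP n) = q := by
  obtain ⟨f, hf0, hf1⟩ := h.exists_continuousMap_affineLine
  let a : (Set.univ : Set (Fin 1 → ℂ)) := ⟨0, trivial⟩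
  let b : (Set.univ : Set (Fin 1 → ℂ)) := ⟨1, trivial⟩
  have hfin : ({a, b} : Set (Set.univ : Set (Fin 1 → ℂ))).Finite := Set.toFinite _
  have hUa : IsOpen {y : (Set.univ : Set (Fin 1 → ℂ)) | (y.1 0).re < 1 / 3} :=
    isOpen_lt continuous_re_affineLine continuous_const
  have hUb : IsOpen {y : (Set.univ : Set (Fin 1 → ℂ)) | 2 / 3 < (y.1 0).re} :=
    isOpen_lt continuous_const continuous_re_affineLine
  have hhol : HolomorphicNear f {a, b} := by
    refine ⟨_, hUa.union hUb, ?_, ?_⟩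
    · rintro y (rfl | rfl)
      · left; simp [a]
      · right; simp [b]; norm_num
    · rintro x (hx | hx)
      · refine HolomorphicAt.of_eventuallyEq_const (p := f x) ?_
        filter_upwards [hUa.mem_nhds hx] with y hy
        exact Subtype.ext ((hf0 y hy).trans (hf0 x hx).symm)
      · refine HolomorphicAt.of_eventuallyEq_const (p := f x) ?_
        filter_upwards [hUb.mem_nhds hx] with y hy
        exact Subtype.ext ((hf1 y hy).trans (hf1 x hx).symm)
  -- The surface is ℂ itself (`m = 0`); the choice `ε = 1` is arbitrary, and order `k = 1` already
  -- fixes the values.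
  obtain ⟨F, hF, -, -, hFA⟩ := hO 0 Set.univ isAffineRiemannSurface_univ {a, b}
    hfin.isRungeCompact_univ {a, b} hfin subset_rfl f hhol 1 one_pos 1 le_rfl
  refine ⟨F, hF, ?_, ?_⟩
  · rw [show F ⟨0, trivial⟩ = f a from (hFA a (by simp)).apply_eq le_rfl]
    exact hf0 a (by simp [a])
  · rw [show F ⟨1, trivial⟩ = f b from (hFA b (by simp)).apply_eq le_rfl]
    exact hf1 b (by simp [b]; norm_num)

theorem IsAOkaOne.isRationallyConnected_connectedComponentIn {n : ℕ} {X : Set (CP n)}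
    (hX : IsProjectiveManifold X) (hO : IsAOkaOne X) {x : CP n} (hx : x ∈ X) :
    IsRationallyConnected (connectedComponentIn X x) := by
  refine ⟨isConnected_connectedComponentIn_iff.2 hx, fun p hp q hq => ?_⟩
  obtain ⟨F, hF, h0, h1⟩ :=
    hO.exists_affineMorphism (hX.joinedIn_of_mem_connectedComponentIn hp hq)
  obtain ⟨φ, hφ, hrange, hmem⟩ := hF.exists_extension hX.algebraic
  refine ⟨φ, hφ, fun t => ?_, h0 ▸ hrange _, h1 ▸ hrange _⟩
  have := hmem ⟨0, trivial⟩ t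
  rwa [h0, ← connectedComponentIn_eq hp] at this

theorem mainTheorem12 (n : ℕ) (X : Set (CP n)) (hX : IsProjectiveManifold X)
    (hO : IsAOkaOne X) :
    (IsConnected X → IsRationallyConnected X) ∧
    ∀ x ∈ X, IsRationallyConnected (connectedComponentIn X x) := by
  refine ⟨fun hc => ?_, fun x hx => hO.isRationallyConnected_connectedComponentIn hX hx⟩
  obtain ⟨x, hx⟩ := hc.nonempty
  have := hO.isRationallyConnected_connectedComponentIn hX hx
  rwa [hc.isPreconnected.connectedComponentIn hx] at this
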